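/- Let $M$ be a smooth $n$-dimensional manifold, $\mathbb TM=TM\oplus T^*M$ with pairing $\langle X+\xi,Y+\eta\rangle=\eta(X)+\xi(Y)$, and let $H$ be a closed three-form. For local sections $a=X+\xi$, $b=Y+\eta$ of $\mathbb TM$ let $$[[a,b]]^H=[X,Y]+L_X\eta-\iota_Yd\xi+\iota_Y\iota_XH,\qquad [[a,b]]^H_{sk}=\tfrac12\big([[a,b]]^H-[[b,a]]^H\big).$$ Let $D$ be a Courant algebroid connection on $\mathbb TM$, i.e. $D_a b$ is function-linear in $a$, additive in $b$, and $D_a(fb)=fD_ab+X(f)\,b$. Write $D=\nabla+V$, i.e. $D_{X+\xi}=\nabla_X+V_\xi$ with $\nabla$ an ordinary connection on $\mathbb TM$ and $V$ a section of $TM\otimes\mathrm{End}(\mathbb TM)$. Let $\nabla^K$ be an affine connection on $M$ (also acting on one-forms). The $K$-torsion of $D$ is $T^K_D=T_\nabla+T_V+T^{(1,1)K}$, i.e. $$T^K_D(a,b)=T_\nabla(X,Y)+T_V(\xi,\eta)+T^{(1,1)K}(X,\eta)-T^{(1,1)K}(Y,\xi),$$ $$T_\nabla(X,Y)=\nabla_XY-\nabla_YX-[X,Y],\quad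 T_V(\xi,\eta)=V_\xi\eta-V_\eta\xi,\quad T^{(1,1)K}(X,\eta)=\nabla_X\eta-\nabla^K_X\eta-V_\eta X .$$ Put $$\tilde K(a,b)=[[a,b]]^H_{sk}-[X,Y]+\nabla^K_Y\xi-\nabla^K_X\eta ,\qquad T_D(a,b)=D_ab-D_ba-[[a,b]]^H_{sk}.$$ **(1)** For all local sections $a,b$ of $\mathbb TM$, $$T^K_D(a,b)=T_D(a,b)+\tilde K(a,b).$$ With the Dorfman bracket in place of its skew-symmetrization, $$T^K_D(a,b)=D_ab-D_ba-[[a,b]]^H+\tilde K(a,b)+\tfrac12\,d\langle a,b\rangle .$$ If the flux is included in the first component, i.e. $T_\nabla(X,Y)$ is replaced by $T_\nabla(X,Y)+H(X,Y,\cdot)$, the resulting tensor equals $D_ab-D_ba-[[a,b]]^{0}_{sk}+\tilde K(a,b)$, where $[[\cdot,\cdot]]^{0}$ is the untwisted bracket. **(2)** Let $L\subset\mathbb TM$ be a Dirac structure for $[[\cdot,\cdot]]^H$: a subbundle with $L=L^\perp$ that is closed under the bracket. There is a unique smooth section $\phi^{KL}$ of $\Lambda^2L^*\otimes T^*M$ given,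 in every chart and for all local sections $a=a^\mu\partial_\mu+a_\mu dx^\mu$, $b=b^\mu\partial_\mu+b_\mu dx^\mu$ of $L$, by $$\phi^{KL}_\mu(a,b)=a^\kappa\,\partial_\mu b_\kappa+a_\kappa\,\partial_\mu b^\kappa+K_\nu{}^\kappa{}_\mu\,(a^\nu b_\kappa-b^\nu a_\kappa),\qquad \nabla^K_{\partial_\nu}dx^\kappa=K_\nu{}^\kappa{}_\mu\,dx^\mu .$$ For all local sections $a=X+\xi$, $b=Y+\eta$ of $L$, the obstruction is $\tilde K|_L$ up to sign and flux: $$\tilde K(a,b)=-\phi^{KL}(a,b)+H(X,Y,\cdot)\in T^*M,$$ so $\tilde K|_L=-\phi^{KL}$ when $H=0$. Moreover $$\tilde K(a,b)=\mathrm{pr}_{T^*M}[[a,b]]^H+\nabla^K_Y\xi-\nabla^K_X\eta,\qquad T^K_D(a,b)=D_ab-D_ba-[[a,b]]^H+\tilde K(a,b);$$ that is, $\tilde K|_L$ is the difference between the $K$-torsion and the Lie algebroid torsion expression on $L$. -/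

import Mathlib

open Bundle
open scoped Manifold ContDiff

noncomputable section

namespace CourantTorsion

/-! ## The generalized tangent bundle

`M` is an `n`-dimensional smooth manifold without boundary.  Sections are dependent functions on
`M`; smoothness is smoothness as a map to the total space of the bundle. -/

/-- The model space `ℝⁿ`. -/
abbrev Mod (n : ℕ) : Type := EuclideanSpace ℝ (Fin n)

/-- The tangent space `T_x M`. -/
abbrev Tan (n : ℕ) {M : Type*} [TopologicalSpace M] [ChartedSpace (EuclideanSpace ℝ (Fin n)) M]
    (x : M) : Type := TangentSpace (𝓡 n) x

/-- The cotangent space `T*_x M`. -/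
abbrev Cot (n : ℕ) {M : Type*} [TopologicalSpace M] [ChartedSpace (EuclideanSpace ℝ (Fin n)) M]
    (x : M) : Type := TangentSpace (𝓡 n) x →L[ℝ] ℝ

/-- The fibre `T_x M ⊕ T*_x M` of the generalized tangent bundle `𝕋M`; the anchor `ρ` is the
first projection and `ρ_{T*}` is the second one. -/
abbrev GenTan (n : ℕ) {M : Type*} [TopologicalSpace M]
    [ChartedSpace (EuclideanSpace ℝ (Fin n)) M] (x : M) : Type := Tan n x × Cot n x

/-- The model fibre of `𝕋M`. -/
abbrev GenMod (n : ℕ) : Type := Mod n × (Mod n →L[ℝ] ℝ)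

variable {n : ℕ} {M : Type*} [TopologicalSpace M] [ChartedSpace (EuclideanSpace ℝ (Fin n)) M]

/-- The natural symmetric pairing `⟨X + ξ, Y + η⟩ = η(X) + ξ(Y)` on a fibre of `𝕋M`. -/
def pairing {x : M} (u v : GenTan n x) : ℝ := v.2 u.1 + u.2 v.1

/-- The differential `df` of a real function, as a one-form. -/
abbrev dfun (f : M → ℝ) (x : M) : Cot n x := mvfderiv (𝓡 n) f x

variable [IsManifold (𝓡 n) ∞ M]

/-- Differentiability of a vector field at a point. -/
abbrev DiffVec (X : ∀ x : M, Tan n x) (x : M) : Prop :=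
  MDifferentiableAt (𝓡 n) ((𝓡 n).prod 𝓘(ℝ, Mod n))
    (fun y => TotalSpace.mk' (Mod n) (E := fun y : M => TangentSpace (𝓡 n) y) y (X y)) x

/-- Differentiability of a one-form at a point. -/
abbrev DiffForm (ξ : ∀ x : M, Cot n x) (x : M) : Prop :=
  MDifferentiableAt (𝓡 n) ((𝓡 n).prod 𝓘(ℝ, Mod n →L[ℝ] ℝ))
    (fun y => TotalSpace.mk' (Mod n →L[ℝ] ℝ)
      (E := fun y : M => TangentSpace (𝓡 n) y →L[ℝ] ℝ) y (ξ y)) x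

/-- Differentiability of a section of `𝕋M` at a point. -/
abbrev DiffSec (a : ∀ x : M, GenTan n x) (x : M) : Prop :=
  MDifferentiableAt (𝓡 n) ((𝓡 n).prod 𝓘(ℝ, GenMod n))
    (fun y => TotalSpace.mk' (GenMod n)
      (E := fun y : M => TangentSpace (𝓡 n) y × (TangentSpace (𝓡 n) y →L[ℝ] ℝ)) y (a y)) x

/-- Smoothness of a vector field on a set. -/
abbrev SmoothVec (U : Set M) (X : ∀ x : M, Tan n x) : Prop :=
  ContMDiffOn (𝓡 n) ((𝓡 n).prod 𝓘(ℝ, Mod n)) ∞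
    (fun y => TotalSpace.mk' (Mod n) (E := fun y : M => TangentSpace (𝓡 n) y) y (X y)) U

/-- Smoothness of a one-form on a set. -/
abbrev SmoothForm (U : Set M) (ξ : ∀ x : M, Cot n x) : Prop :=
  ContMDiffOn (𝓡 n) ((𝓡 n).prod 𝓘(ℝ, Mod n →L[ℝ] ℝ)) ∞
    (fun y => TotalSpace.mk' (Mod n →L[ℝ] ℝ)
      (E := fun y : M => TangentSpace (𝓡 n) y →L[ℝ] ℝ) y (ξ y)) U

/-- Smoothness of a section of `𝕋M` on a set. -/
abbrev SmoothSec (U : Set M) (a : ∀ x : M, GenTan n x) : Prop :=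
  ContMDiffOn (𝓡 n) ((𝓡 n).prod 𝓘(ℝ, GenMod n)) ∞
    (fun y => TotalSpace.mk' (GenMod n)
      (E := fun y : M => TangentSpace (𝓡 n) y × (TangentSpace (𝓡 n) y →L[ℝ] ℝ)) y (a y)) U

/-! ## Exterior derivative and Lie derivative of one-forms -/

/-- `Y(ξ(Z)) - Z(ξ(Y)) - ξ([Y,Z])`, the invariant formula for `dξ(Y,Z)`. -/
def extDerivAux (ξ : ∀ x : M, Cot n x) (Y Z : ∀ x : M, Tan n x) (x : M) : ℝ :=
  dfun (n := n) (fun y => ξ y (Z y)) x (Y x) - dfun (n := n) (fun y => ξ y (Y y)) x (Z x)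
    - ξ x (VectorField.mlieBracket (𝓡 n) Y Z x)

theorem differentiable_pair {ξ : ∀ x : M, Cot n x} {x : M} (hξ : DiffForm ξ x)
    {Z : ∀ x : M, Tan n x} (hZ : DiffVec Z x) :
    MDifferentiableAt (𝓡 n) 𝓘(ℝ, ℝ) (fun y => ξ y (Z y)) x := by
  have h := MDifferentiableAt.clm_bundle_apply (E₂ := Bundle.Trivial M ℝ) (F₂ := ℝ) hξ hZ
  rw [mdifferentiableAt_totalSpace] at h
  exact h.2

theorem extDerivAux_tensorial_left {ξ : ∀ x : M, Cot n x} {x : M} (hξ : DiffForm ξ x)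
    (Z : ∀ x : M, Tan n x) :
    TensorialAt (𝓡 n) (Mod n) (fun Y => extDerivAux ξ Y Z x) x where
  smul {f Y} hf hY := by
    have h := differentiable_pair hξ hY
    simp [extDerivAux, VectorField.mlieBracket_smul_left hf hY, mvfderiv_fun_mul hf h]
    ring
  add {Y Y'} hY hY' := by
    simp [extDerivAux, VectorField.mlieBracket_add_left hY hY',
      mvfderiv_fun_add (differentiable_pair hξ hY) (differentiable_pair hξ hY')]
    ring

theorem extDerivAux_tensorial_right {ξ : ∀ x : M, Cot n x} {x : M} (hξ : DiffForm ξ x)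
    (Y : ∀ x : M, Tan n x) :
    TensorialAt (𝓡 n) (Mod n) (fun Z => extDerivAux ξ Y Z x) x where
  smul {f Z} hf hZ := by
    have h := differentiable_pair hξ hZ
    simp [extDerivAux, VectorField.mlieBracket_smul_right hf hZ, mvfderiv_fun_mul hf h]
    ring
  add {Z Z'} hZ hZ' := by
    simp [extDerivAux, VectorField.mlieBracket_add_right hZ hZ',
      mvfderiv_fun_add (differentiable_pair hξ hZ) (differentiable_pair hξ hZ')]
    ring

open Classical in
/-- The exterior derivative `dξ` of a one-form: `extDerivOneForm ξ x u v = dξ_x(u, v)`.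
(It is set to be `0` at points where `ξ` is not differentiable.) -/
def extDerivOneForm (ξ : ∀ x : M, Cot n x) (x : M) : Tan n x →L[ℝ] Cot n x :=
  if h : DiffForm ξ x then
    TensorialAt.mkHom₂ (I := 𝓡 n) (F := Mod n) (F' := Mod n)
      (fun Y Z => extDerivAux ξ Y Z x) x
      (fun Z _ => extDerivAux_tensorial_left h Z)
      (fun Y _ => extDerivAux_tensorial_right h Y)
  else 0

/-- The Lie derivative `L_X η = d(η(X)) + ι_X dη` of a one-form. -/
def lieDerivOneForm (X : ∀ x : M, Tan n x) (η : ∀ x : M, Cot n x) (x : M) : Cot n x :=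
  dfun (n := n) (fun y => η y (X y)) x + extDerivOneForm η x (X x)

/-! ## Closed three-forms and the (twisted) Courant bracket -/

/-- A trilinear form on each tangent space. -/
abbrev Trilin (n : ℕ) (M : Type*) [TopologicalSpace M]
    [ChartedSpace (EuclideanSpace ℝ (Fin n)) M] : Type _ :=
  ∀ x : M, TangentSpace (𝓡 n) x →L[ℝ] TangentSpace (𝓡 n) x →L[ℝ] TangentSpace (𝓡 n) x →L[ℝ] ℝ

/-- The zero three-form. -/
def zeroFlux : Trilin n M := fun _ => 0

/-- `H` is a smooth closed three-form on `M`: it is alternating, smooth, and `dH = 0`, where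
`dH(X₀,X₁,X₂,X₃)` is written by the invariant formula on vector fields. -/
structure IsClosedThreeForm (H : Trilin n M) : Prop where
  alt_left : ∀ (x : M) (u v : Tan n x), H x u u v = 0
  alt_right : ∀ (x : M) (u v : Tan n x), H x u v v = 0
  smooth : ∀ (U : Set M) (X Y Z : ∀ y : M, Tan n y), IsOpen U →
    SmoothVec U X → SmoothVec U Y → SmoothVec U Z →
      ContMDiffOn (𝓡 n) 𝓘(ℝ, ℝ) ∞ (fun y => H y (X y) (Y y) (Z y)) U
  closed : ∀ (x : M) (W X Y Z : ∀ y : M, Tan n y),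
    DiffVec W x → DiffVec X x → DiffVec Y x → DiffVec Z x →
      dfun (n := n) (fun y => H y (X y) (Y y) (Z y)) x (W x)
      - dfun (n := n) (fun y => H y (W y) (Y y) (Z y)) x (X x)
      + dfun (n := n) (fun y => H y (W y) (X y) (Z y)) x (Y x)
      - dfun (n := n) (fun y => H y (W y) (X y) (Y y)) x (Z x)
      - H x (VectorField.mlieBracket (𝓡 n) W X x) (Y x) (Z x)
      + H x (VectorField.mlieBracket (𝓡 n) W Y x) (X x) (Z x)
      - H x (VectorField.mlieBracket (𝓡 n) W Z x) (X x) (Y x)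
      - H x (VectorField.mlieBracket (𝓡 n) X Y x) (W x) (Z x)
      + H x (VectorField.mlieBracket (𝓡 n) X Z x) (W x) (Y x)
      - H x (VectorField.mlieBracket (𝓡 n) Y Z x) (W x) (X x) = 0

/-- The Dorfman bracket `[[X+ξ, Y+η]]^H = L_X(Y+η) - ι_Y dξ + ι_Y ι_X H`. -/
def dorfman (H : Trilin n M) (a b : ∀ x : M, GenTan n x) (x : M) : GenTan n x :=
  (VectorField.mlieBracket (𝓡 n) (fun y => (a y).1) (fun y => (b y).1) x,
    lieDerivOneForm (fun y => (a y).1) (fun y => (b y).2) x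
      - extDerivOneForm (fun y => (a y).2) x (b x).1 + H x (a x).1 (b x).1)

/-- The skew-symmetrized bracket `[[a,b]]_sk = ½([[a,b]] - [[b,a]])`. -/
def courantSk (H : Trilin n M) (a b : ∀ x : M, GenTan n x) (x : M) : GenTan n x :=
  (1 / 2 : ℝ) • (dorfman H a b x - dorfman H b a x)

/-! ## Generalized connections on `𝕋M` -/

/-- A generalized (Courant algebroid) connection `D : Γ(𝕋M) → Γ(𝕋M ⊗ 𝕋M)` on `𝕋M`;
`D b x (a x)` is `(D_a b)(x)`.  The Leibniz rule reads `D_a(f b) = f D_a b + (ρ(a) f) b`.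
As for Mathlib's `CovariantDerivative`, the operator is defined on all sections and constrained
only on those which are differentiable. -/
structure GenConnection (n : ℕ) (M : Type*) [TopologicalSpace M]
    [ChartedSpace (EuclideanSpace ℝ (Fin n)) M] [IsManifold (𝓡 n) ∞ M] where
  /-- the operator `D` -/
  toFun : (∀ x : M, GenTan n x) → ∀ x : M, GenTan n x →L[ℝ] GenTan n x
  add : ∀ {b b' : ∀ x : M, GenTan n x} {x : M}, DiffSec b x → DiffSec b' x →
    toFun (b + b') x = toFun b x + toFun b' x
  leibniz : ∀ {b : ∀ x : M, GenTan n x} {f : M → ℝ} {x : M}, DiffSec b x →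
    MDifferentiableAt (𝓡 n) 𝓘(ℝ, ℝ) f x →
    toFun (f • b) x = f x • toFun b x
      + ((dfun (n := n) f x).comp (ContinuousLinearMap.fst ℝ (Tan n x) (Cot n x))).smulRight (b x)
  smooth : ∀ {U : Set M} {a b : ∀ x : M, GenTan n x}, IsOpen U → SmoothSec U a → SmoothSec U b →
    SmoothSec U (fun x => toFun b x (a x))

namespace GenConnection

/-- `(D_a b)(x)`. -/
def app (D : GenConnection n M) (a b : ∀ x : M, GenTan n x) (x : M) : GenTan n x :=
  D.toFun b x (a x)

/-- The ordinary connection `∇` on the vector bundle `𝕋M` in the decomposition `D = ∇ + V`: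
`∇_X = D_{X+0}`. -/
def nabla (D : GenConnection n M) :
    CovariantDerivative (𝓡 n) (GenMod n) (fun x : M => TangentSpace (𝓡 n) x ×
      (TangentSpace (𝓡 n) x →L[ℝ] ℝ)) where
  toFun b x := (D.toFun b x).comp (ContinuousLinearMap.inl ℝ (Tan n x) (Cot n x))
  isCovariantDerivativeOnUniv :=
    { add := fun hσ hσ' _ => by rw [D.add hσ hσ', ContinuousLinearMap.add_comp]
      leibniz := fun hσ hg _ => by
        rw [D.leibniz hσ hg]
        ext v <;> simp }

/-- The tensor `V` in the decomposition `D = ∇ + V`: `V_ν b = D_{0+ν} b`. -/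
def tensorV (D : GenConnection n M) (ν : ∀ x : M, Cot n x) (b : ∀ x : M, GenTan n x) (x : M) :
    GenTan n x :=
  D.toFun b x (0, ν x)

/-- `D_a = ∇_{ρ(a)} + V_{ρ_{T*}(a)}`. -/
theorem app_eq (D : GenConnection n M) (a b : ∀ x : M, GenTan n x) (x : M) :
    D.app a b x = D.nabla.toFun b x (a x).1 + D.tensorV (fun y => (a y).2) b x := by
  have h : (a x : GenTan n x) = ((a x).1, (0 : Cot n x)) + ((0 : Tan n x), (a x).2) := by simp
  change D.toFun b x (a x) = D.toFun b x ((a x).1, 0) + D.toFun b x (0, (a x).2)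
  rw [← (D.toFun b x).map_add]
  simp

/-- `V_ν` is linear over functions, i.e. `V` is a section of `TM ⊗ End(𝕋M)`. -/
theorem tensorV_smul (D : GenConnection n M) (ν : ∀ x : M, Cot n x) (b : ∀ x : M, GenTan n x)
    (f : M → ℝ) (x : M) (hb : DiffSec b x) (hf : MDifferentiableAt (𝓡 n) 𝓘(ℝ, ℝ) f x) :
    D.tensorV ν (f • b) x = f x • D.tensorV ν b x := by
  simp [tensorV, D.leibniz hb hf]

end GenConnection

/-! ## The affine connection `∇^K` on one-forms -/

/-- Affine connections on `M`, i.e. covariant derivatives on `TM`. -/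
abbrev AffineConnection (n : ℕ) (M : Type*) [TopologicalSpace M]
    [ChartedSpace (EuclideanSpace ℝ (Fin n)) M] [IsManifold (𝓡 n) ∞ M] : Type _ :=
  CovariantDerivative (𝓡 n) (Mod n) (fun x : M => TangentSpace (𝓡 n) x)

theorem dualConn_tensorial (K : AffineConnection n M)
    {η : ∀ x : M, Cot n x} {x : M} (hη : DiffForm η x) (v : Tan n x) :
    TensorialAt (𝓡 n) (Mod n) (fun Z : ∀ x : M, TangentSpace (𝓡 n) x =>
      dfun (n := n) (fun y => η y (Z y)) x v - η x (K.toFun Z x v)) x where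
  smul {f Z} hf hZ := by
    have h := differentiable_pair hη hZ
    simp [K.isCovariantDerivativeOnUniv.leibniz hZ hf, mvfderiv_fun_mul hf h]
    ring
  add {Z Z'} hZ hZ' := by
    simp [K.isCovariantDerivativeOnUniv.add hZ hZ',
      mvfderiv_fun_add (differentiable_pair hη hZ) (differentiable_pair hη hZ')]
    ring

open Classical in
/-- The connection induced on one-forms by an affine connection:
`(∇^K_X η)(Z) = X(η(Z)) - η(∇^K_X Z)`.
(It is set to be `0` at points where `η` is not differentiable.) -/
def dualConn (K : AffineConnection n M)
    (X : ∀ x : M, Tan n x) (η : ∀ x : M, Cot n x) (x : M) : Cot n x :=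
  if h : DiffForm η x then
    TensorialAt.mkHom (I := 𝓡 n) (F := Mod n)
      (fun Z : ∀ x : M, TangentSpace (𝓡 n) x =>
        dfun (n := n) (fun y => η y (Z y)) x (X x) - η x (K.toFun Z x (X x))) x
      (dualConn_tensorial K h (X x))
  else 0

/-! ## Naive torsion, `K̃`, and the `K`-torsion -/

/-- The naive torsion operator `D_a b - D_b a - [[a,b]]_sk`. -/
def naiveTorsion (H : Trilin n M) (D : GenConnection n M) (a b : ∀ x : M, GenTan n x) (x : M) :
    GenTan n x :=
  D.app a b x - D.app b a x - courantSk H a b x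

/-- The operator `D_a b - D_b a - [[a,b]]` with the (non skew-symmetric) Dorfman bracket. -/
def dorfmanTorsion (H : Trilin n M) (D : GenConnection n M) (a b : ∀ x : M, GenTan n x) (x : M) :
    GenTan n x :=
  D.app a b x - D.app b a x - dorfman H a b x

/-- `K̃(X+ξ, Y+η) = [[X+ξ, Y+η]]_sk^H - [X,Y] + ∇^K_Y ξ - ∇^K_X η`. -/
def tildeK (H : Trilin n M)
    (K : AffineConnection n M)
    (a b : ∀ x : M, GenTan n x) (x : M) : GenTan n x :=
  courantSk H a b x
    - (VectorField.mlieBracket (𝓡 n) (fun y => (a y).1) (fun y => (b y).1) x, 0)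
    + (0, dualConn K (fun y => (b y).1) (fun y => (a y).2) x)
    - (0, dualConn K (fun y => (a y).1) (fun y => (b y).2) x)

/-- `⟨T_∇, X ∧ Y⟩ = ∇_X Y - ∇_Y X - [X,Y]`. -/
def torsionNabla (D : GenConnection n M) (X Y : ∀ x : M, Tan n x) (x : M) : GenTan n x :=
  D.nabla.toFun (fun y => (Y y, 0)) x (X x) - D.nabla.toFun (fun y => (X y, 0)) x (Y x)
    - (VectorField.mlieBracket (𝓡 n) X Y x, 0)

/-- `⟨T_V, ν ∧ μ⟩ = V_ν μ - V_μ ν`. -/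
def torsionV (D : GenConnection n M) (ν μ : ∀ x : M, Cot n x) (x : M) : GenTan n x :=
  D.tensorV ν (fun y => (0, μ y)) x - D.tensorV μ (fun y => (0, ν y)) x

/-- `T^{(1,1)K}_{∇,V}(X, ν) = ∇_X ν - ∇^K_X ν - V_ν X`. -/
def torsionMixed (D : GenConnection n M)
    (K : AffineConnection n M)
    (X : ∀ x : M, Tan n x) (ν : ∀ x : M, Cot n x) (x : M) : GenTan n x :=
  D.nabla.toFun (fun y => (0, ν y)) x (X x) - (0, dualConn K X ν x)
    - D.tensorV ν (fun y => (X y, 0)) x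

/-- The `K`-torsion `T^K_D = T_∇ + T_V + T^{(1,1)K}_{∇,V}`, evaluated as a two-form on `𝕋M`. -/
def kTorsion (D : GenConnection n M)
    (K : AffineConnection n M)
    (a b : ∀ x : M, GenTan n x) (x : M) : GenTan n x :=
  torsionNabla D (fun y => (a y).1) (fun y => (b y).1) x
    + torsionV D (fun y => (a y).2) (fun y => (b y).2) x
    + (torsionMixed D K (fun y => (a y).1) (fun y => (b y).2) x
      - torsionMixed D K (fun y => (b y).1) (fun y => (a y).2) x)

/-- The variant of the `K`-torsion in which the flux term `H(X, Y, ·)` is included in the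
component `T_∇(X, Y)`. -/
def kTorsionFlux (H : Trilin n M) (D : GenConnection n M)
    (K : AffineConnection n M)
    (a b : ∀ x : M, GenTan n x) (x : M) : GenTan n x :=
  kTorsion D K a b x + (0, H x (a x).1 (b x).1)

/-! ## Dirac structures -/

/-- A Dirac structure: a smooth subbundle `L ⊆ 𝕋M` which is maximally isotropic (`L = L^⊥`) and
involutive with respect to the Courant bracket. -/
structure DiracStructure (H : Trilin n M) where
  /-- the fibres of `L` -/
  fibre : ∀ x : M, Submodule ℝ (GenTan n x)
  subbundle : ∀ x₀ : M, ∃ (U : Set M) (k : ℕ) (e : Fin k → ∀ x : M, GenTan n x),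
    IsOpen U ∧ x₀ ∈ U ∧ (∀ i, SmoothSec U (e i)) ∧
      ∀ x ∈ U, LinearIndependent ℝ (fun i => e i x) ∧
        Submodule.span ℝ (Set.range fun i => e i x) = fibre x
  lagrangian : ∀ (x : M) (u : GenTan n x), u ∈ fibre x ↔ ∀ v ∈ fibre x, pairing u v = 0
  involutive : ∀ (U : Set M) (a b : ∀ x : M, GenTan n x), IsOpen U → SmoothSec U a →
    SmoothSec U b → (∀ x ∈ U, a x ∈ fibre x) → (∀ x ∈ U, b x ∈ fibre x) →
      ∀ x ∈ U, dorfman H a b x ∈ fibre x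

/-! ## Coordinates and the obstruction tensor `φ^{KL}` -/

section Coordinates

/-- The coordinate vector field `∂_μ` of a chart `e`. -/
def coordVec (e : OpenPartialHomeomorph M (Mod n)) (μ : Fin n) (x : M) : Tan n x :=
  (mfderiv (𝓡 n) 𝓘(ℝ, Mod n) e x).inverse (EuclideanSpace.single μ (1 : ℝ))

/-- The coordinate one-form `dx^κ` of a chart `e`. -/
def coordForm (e : OpenPartialHomeomorph M (Mod n)) (κ : Fin n) (x : M) : Cot n x :=
  dfun (n := n) (fun y => e y κ) x

/-- The component `X^κ` in the chart `e` of the vector part of a section of `𝕋M`. -/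
def compVec (e : OpenPartialHomeomorph M (Mod n)) (a : ∀ x : M, GenTan n x) (κ : Fin n) (x : M) :
    ℝ := coordForm e κ x (a x).1

/-- The component `ξ_κ` in the chart `e` of the form part of a section of `𝕋M`. -/
def compForm (e : OpenPartialHomeomorph M (Mod n)) (a : ∀ x : M, GenTan n x) (κ : Fin n) (x : M) :
    ℝ := (a x).2 (coordVec e κ x)

/-- The connection coefficients `K_ν{}^κ{}_μ` of `∇^K` in the chart `e`, in the convention
`∇^K_{∂_ν} dx^κ = K_ν{}^κ{}_μ dx^μ`. -/
def connCoeff (K : AffineConnection n M)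
    (e : OpenPartialHomeomorph M (Mod n)) (ν κ μ : Fin n) (x : M) : ℝ :=
  dualConn K (coordVec e ν) (coordForm e κ) x (coordVec e μ x)

/-- The local expression, in the chart `e`, of the `μ`-component of `φ^{KL}(a, b)`:
`a^κ ∂_μ b_κ + ∂_μ b^κ a_κ + K_ν{}^κ{}_μ a^ν b_κ - K_ν{}^κ{}_μ b^ν a_κ`. -/
def obstructionLocal (K : AffineConnection n M)
    (e : OpenPartialHomeomorph M (Mod n)) (a b : ∀ x : M, GenTan n x) (μ : Fin n) (x : M) : ℝ :=
  (∑ κ, (compVec e a κ x * dfun (n := n) (compForm e b κ) x (coordVec e μ x)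
      + dfun (n := n) (compVec e b κ) x (coordVec e μ x) * compForm e a κ x))
    + ∑ ν, ∑ κ, (connCoeff K e ν κ μ x * compVec e a ν x * compForm e b κ x
      - connCoeff K e ν κ μ x * compVec e b ν x * compForm e a κ x)

end Coordinates

/-- `φ` is the obstruction tensor `φ^{KL} ∈ Γ(Λ²L* ⊗ T*M)`: a smooth section of `Λ²L* ⊗ T*M` which
in every chart `e` of `M`, on local sections `a, b` of `L`, is given by `obstructionLocal`. -/
structure IsObstructionTensor {H : Trilin n M} (L : DiracStructure H)
    (K : AffineConnection n M)
    (φ : ∀ x : M, L.fibre x →ₗ[ℝ] L.fibre x →ₗ[ℝ] Cot n x) : Prop where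
  alt : ∀ (x : M) (u : L.fibre x), φ x u u = 0
  smooth : ∀ (U : Set M) (a b : ∀ x : M, L.fibre x), IsOpen U →
    SmoothSec U (fun x => (a x : GenTan n x)) → SmoothSec U (fun x => (b x : GenTan n x)) →
      SmoothForm U (fun x => φ x (a x) (b x))
  local_eq : ∀ e ∈ IsManifold.maximalAtlas (𝓡 n) ∞ M, ∀ (U : Set M) (a b : ∀ x : M, L.fibre x),
    IsOpen U → U ⊆ e.source →
    SmoothSec U (fun x => (a x : GenTan n x)) → SmoothSec U (fun x => (b x : GenTan n x)) →
      ∀ x ∈ U, ∀ μ : Fin n, φ x (a x) (b x) (coordVec e μ x)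
        = obstructionLocal K e (fun y => (a y : GenTan n y)) (fun y => (b y : GenTan n y)) μ x

end CourantTorsion

end

open CourantTorsion

/-!
The operators `D_a b` are additive in both arguments, so splitting `a` and `b` into their vector and
form parts turns the three components of the `K`-torsion into
`D_a b - D_b a - [X,Y] + ∇^K_Y ξ - ∇^K_X η` (`kTorsion_eq`).  The bracket cancels against the one in
`K̃`, which gives the formula with the naive torsion.  The symmetric part of the Dorfman bracket is
`½ d⟨a,b⟩` (`dorfman_add_swap`) and the flux is skew, which gives the other two formulas.

For the second part, let `∇̄_Z X = ∇^K_X Z - [X,Z]` be the conjugate connection.  In `K̃(a,b)(Z)` the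
derivatives of `η(Z)` along `X` and of `ξ(Z)` along `Y` cancel (`tildeK_snd_apply`), leaving
`K̃(a,b)(Z) - H(X,Y,Z) = -½ Z⟨a,b⟩ + Z(ξ(Y)) + η(∇̄_Z X) - ξ(∇̄_Z Y)`.
For a coordinate field `Z = ∂_μ` the brackets `[∂_ν,∂_μ]` vanish, and expanding in the coordinate
frame identifies this with minus the local expression of `φ^{KL}`, up to `½ ∂_μ⟨a,b⟩`
(`obstructionLocal_eq`).  Hence on a Dirac structure, where the pairing vanishes identically, the
local expressions in all charts are the components of the one-form `-K̃(a,b) + H(X,Y,·)`, here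
`obstructionForm`.

This also yields tensoriality without differentiating coefficients of sections of `L` in a frame.
The local expression depends only on the value of `a` at the point, linearly; the invariant
expression is skew in `a` and `b`; so the same holds for `b`.  The tensor `φ^{KL}` is obtained by
evaluating `obstructionForm` on extensions of vectors of `L` with constant coefficients in a local
frame (`exists_obstructionTensor`).  It is smooth because its components in a chart are, and it is
unique because vectors of `L` extend to local sections and the `∂_μ` form a basis.
-/

open Bundle
open scoped Manifold ContDiff

noncomputable section

namespace CourantTorsion

variable {n : ℕ} {M : Type*} [TopologicalSpace M] [ChartedSpace (EuclideanSpace ℝ (Fin n)) M]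
  [IsManifold (𝓡 n) ∞ M] {x : M} {e : OpenPartialHomeomorph M (Mod n)} {H : Trilin n M}

/-! ### Sections of `𝕋M` and their components -/

theorem diffSec_iff {a : ∀ x : M, GenTan n x} {x : M} :
    DiffSec a x ↔ DiffVec (fun y => (a y).1) x ∧ DiffForm (fun y => (a y).2) x := by
  rw [DiffSec, mdifferentiableAt_section, DiffVec, mdifferentiableAt_section, DiffForm,
    mdifferentiableAt_section]
  exact mdifferentiableAt_prod_module_iff _

theorem smoothSec_iff {a : ∀ x : M, GenTan n x} {U : Set M} :
    SmoothSec U a ↔ SmoothVec U (fun y => (a y).1) ∧ SmoothForm U (fun y => (a y).2) := by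
  simp only [SmoothSec, SmoothVec, SmoothForm, ContMDiffOn, ← forall_and,
     Bundle.contMDiffWithinAt_section]
  refine forall₂_congr fun x hx => ?_
  exact contMDiffWithinAt_prod_module_iff _

theorem DiffVec.diffSec {X : ∀ x : M, Tan n x} {x : M} (hX : DiffVec X x) :
    DiffSec (fun y => (X y, (0 : Cot n y))) x :=
  diffSec_iff.2 ⟨hX, mdifferentiable_zeroSection ..⟩

theorem DiffForm.diffSec {ξ : ∀ x : M, Cot n x} {x : M} (hξ : DiffForm ξ x) :
    DiffSec (fun y => ((0 : Tan n y), ξ y)) x :=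
  diffSec_iff.2 ⟨mdifferentiable_zeroSection .., hξ⟩

theorem SmoothSec.diffSec {a : ∀ x : M, GenTan n x} {U : Set M} (ha : SmoothSec U a)
    (hU : IsOpen U) {x : M} (hx : x ∈ U) : DiffSec a x :=
  (ha.contMDiffAt (hU.mem_nhds hx)).mdifferentiableAt (by simp)

/-! ### The `K`-torsion in terms of `D` -/

/-- `D_a b` splits into its four parts `∇_X Y`, `∇_X η`, `V_ξ Y`, `V_ξ η`. -/
theorem GenConnection.app_eq_add (D : GenConnection n M) {a b : ∀ x : M, GenTan n x} {x : M}
    (hb : DiffSec b x) :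
    D.app a b x = D.nabla.toFun (fun y => ((b y).1, 0)) x (a x).1
      + D.nabla.toFun (fun y => (0, (b y).2)) x (a x).1
      + D.tensorV (fun y => (a y).2) (fun y => ((b y).1, 0)) x
      + D.tensorV (fun y => (a y).2) (fun y => (0, (b y).2)) x := by
  obtain ⟨h1, h2⟩ := diffSec_iff.1 hb
  have hsum : b = (fun y => ((b y).1, (0 : Cot n y))) + fun y => ((0 : Tan n y), (b y).2) := by
    funext y; simp
  have hD := D.add h1.diffSec h2.diffSec
  rw [← hsum] at hD
  rw [D.app_eq]
  change D.toFun b x ((a x).1, 0) + D.toFun b x (0, (a x).2)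
    = D.toFun _ x ((a x).1, 0) + D.toFun _ x ((a x).1, 0) + D.toFun _ x (0, (a x).2)
      + D.toFun _ x (0, (a x).2)
  rw [hD]
  simp only [add_apply]
  abel

/-- The `D`-terms of the three components of the `K`-torsion recombine to `D_a b - D_b a`. -/
theorem kTorsion_eq (D : GenConnection n M) (K : AffineConnection n M)
    {a b : ∀ x : M, GenTan n x} {x : M} (ha : DiffSec a x) (hb : DiffSec b x) :
    kTorsion D K a b x = D.app a b x - D.app b a x
      - (VectorField.mlieBracket (𝓡 n) (fun y => (a y).1) (fun y => (b y).1) x, 0)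
      + (0, dualConn K (fun y => (b y).1) (fun y => (a y).2) x)
      - (0, dualConn K (fun y => (a y).1) (fun y => (b y).2) x) := by
  rw [D.app_eq_add hb, D.app_eq_add ha, kTorsion, torsionNabla, torsionV, torsionMixed,
    torsionMixed]
  abel

/-! ### Skew-symmetrization of the Dorfman bracket -/

theorem IsClosedThreeForm.swap {H : Trilin n M} (hH : IsClosedThreeForm H) (x : M)
    (u v : Tan n x) : H x v u = - H x u v := by
  ext w
  have h := hH.alt_left x (u + v) w
  rw [(H x).map_add, add_apply, (H x u).map_add, (H x v).map_add, add_apply, add_apply, add_apply,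
    hH.alt_left, hH.alt_left] at h
  change H x v u w = - (H x u v w)
  linarith

theorem dfun_pairing {a b : ∀ x : M, GenTan n x} {x : M} (ha : DiffSec a x) (hb : DiffSec b x) :
    dfun (n := n) (fun y => pairing (a y) (b y)) x
      = dfun (n := n) (fun y => (b y).2 (a y).1) x + dfun (n := n) (fun y => (a y).2 (b y).1) x := by
  obtain ⟨ha1, ha2⟩ := diffSec_iff.1 ha
  obtain ⟨hb1, hb2⟩ := diffSec_iff.1 hb
  exact mvfderiv_fun_add (differentiable_pair hb2 ha1) (differentiable_pair ha2 hb1)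

/-- The symmetric part of the Dorfman bracket is exact. -/
theorem dorfman_add_swap {H : Trilin n M} (hH : IsClosedThreeForm H)
    {a b : ∀ x : M, GenTan n x} {x : M} (ha : DiffSec a x) (hb : DiffSec b x) :
    dorfman H a b x + dorfman H b a x = (0, dfun (fun y => pairing (a y) (b y)) x) := by
  rw [dfun_pairing ha hb]
  refine Prod.ext ?_ ?_
  · simp only [dorfman, Prod.fst_add]
    rw [VectorField.mlieBracket_swap_apply, neg_add_cancel]
  · simp only [dorfman, Prod.snd_add, lieDerivOneForm, hH.swap x (a x).1 (b x).1]
    abel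

theorem courantSk_eq {H : Trilin n M} (hH : IsClosedThreeForm H)
    {a b : ∀ x : M, GenTan n x} {x : M} (ha : DiffSec a x) (hb : DiffSec b x) :
    courantSk H a b x
      = dorfman H a b x - (0, (1 / 2 : ℝ) • dfun (fun y => pairing (a y) (b y)) x) := by
  have h := dorfman_add_swap hH ha hb
  have h2 : ((0 : Tan n x), (1 / 2 : ℝ) • dfun (n := n) (fun y => pairing (a y) (b y)) x)
      = (1 / 2 : ℝ) • (dorfman H a b x + dorfman H b a x) := by
    rw [h, Prod.smul_mk, smul_zero]
  rw [h2, courantSk]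
  module

theorem courantSk_eq_zeroFlux_add {H : Trilin n M} (hH : IsClosedThreeForm H)
    (a b : ∀ x : M, GenTan n x) (x : M) :
    courantSk H a b x = courantSk zeroFlux a b x + (0, H x (a x).1 (b x).1) := by
  refine Prod.ext ?_ ?_
  · simp [courantSk, dorfman]
  · simp only [courantSk, dorfman, Prod.snd_add, Prod.smul_snd, Prod.snd_sub,
      hH.swap x (a x).1 (b x).1, zeroFlux, zero_apply]
    module

theorem kTorsion_eq_naiveTorsion_add (H : Trilin n M) (D : GenConnection n M)
    (K : AffineConnection n M) {a b : ∀ x : M, GenTan n x} {x : M} (ha : DiffSec a x)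
    (hb : DiffSec b x) :
    kTorsion D K a b x = naiveTorsion H D a b x + tildeK H K a b x := by
  rw [kTorsion_eq D K ha hb, naiveTorsion, tildeK]
  abel

theorem kTorsion_eq_dorfmanTorsion_add {H : Trilin n M} (hH : IsClosedThreeForm H)
    (D : GenConnection n M) (K : AffineConnection n M) {a b : ∀ x : M, GenTan n x} {x : M}
    (ha : DiffSec a x) (hb : DiffSec b x) :
    kTorsion D K a b x = dorfmanTorsion H D a b x + tildeK H K a b x
      + (0, (1 / 2 : ℝ) • dfun (fun y => pairing (a y) (b y)) x) := by
  rw [kTorsion_eq_naiveTorsion_add H D K ha hb, naiveTorsion, dorfmanTorsion,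
    courantSk_eq hH ha hb]
  abel

theorem kTorsionFlux_eq {H : Trilin n M} (hH : IsClosedThreeForm H)
    (D : GenConnection n M) (K : AffineConnection n M) {a b : ∀ x : M, GenTan n x} {x : M}
    (ha : DiffSec a x) (hb : DiffSec b x) :
    kTorsionFlux H D K a b x = naiveTorsion zeroFlux D a b x + tildeK H K a b x := by
  rw [kTorsionFlux, kTorsion_eq_naiveTorsion_add H D K ha hb, naiveTorsion, naiveTorsion,
    courantSk_eq_zeroFlux_add hH]
  abel

/-! ### `K̃` evaluated on a vector field -/

theorem tildeK_swap (H : Trilin n M) (K : AffineConnection n M) (a b : ∀ x : M, GenTan n x)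
    (x : M) : tildeK H K b a x = - tildeK H K a b x := by
  refine Prod.ext ?_ ?_
  · simp only [tildeK, courantSk, dorfman, Prod.fst_add, Prod.fst_sub, Prod.fst_neg, Prod.smul_fst]
    rw [VectorField.mlieBracket_swap_apply (V := fun y => (b y).1)]
    module
  · simp only [tildeK, courantSk, Prod.snd_add, Prod.snd_sub, Prod.snd_neg, Prod.smul_snd]
    module

theorem tildeK_fst (H : Trilin n M) (K : AffineConnection n M) (a b : ∀ x : M, GenTan n x)
    (x : M) : (tildeK H K a b x).1 = 0 := by
  simp only [tildeK, courantSk, dorfman, Prod.fst_add, Prod.fst_sub, Prod.smul_fst]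
  rw [VectorField.mlieBracket_swap_apply (V := fun y => (b y).1)]
  module

theorem extDerivOneForm_apply {ξ : ∀ x : M, Cot n x} {x : M} (hξ : DiffForm ξ x)
    {Y Z : ∀ x : M, Tan n x} (hY : DiffVec Y x) (hZ : DiffVec Z x) :
    extDerivOneForm ξ x (Y x) (Z x) = extDerivAux ξ Y Z x := by
  rw [extDerivOneForm, dif_pos hξ]
  exact TensorialAt.mkHom₂_apply (I := 𝓡 n) (F := Mod n) (F' := Mod n) _ _ hY hZ

theorem dualConn_apply (K : AffineConnection n M) {η : ∀ x : M, Cot n x} {x : M}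
    (hη : DiffForm η x) (X : ∀ x : M, Tan n x) {Z : ∀ x : M, Tan n x} (hZ : DiffVec Z x) :
    dualConn K X η x (Z x)
      = dfun (n := n) (fun y => η y (Z y)) x (X x) - η x (K.toFun Z x (X x)) := by
  rw [dualConn, dif_pos hη]
  exact TensorialAt.mkHom_apply (I := 𝓡 n) (F := Mod n) _ hZ

/-- The conjugate connection `∇̄_Z X = ∇^K_X Z - [X, Z]` of `∇^K`, whose torsion is opposite to
that of `∇^K`. -/
def conjConn (K : AffineConnection n M) (Z X : ∀ x : M, Tan n x) (x : M) : Tan n x :=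
  K.toFun Z x (X x) - VectorField.mlieBracket (𝓡 n) X Z x

/-- The derivatives of `η(Z)` along `X` and of `ξ(Z)` along `Y` which come from the Lie derivative,
from `dξ` and from `∇^K` cancel; the remaining bracket and connection terms pair up to `∇̄`. -/
theorem tildeK_snd_apply {H : Trilin n M} (hH : IsClosedThreeForm H) (K : AffineConnection n M)
    {a b : ∀ x : M, GenTan n x} {x : M} (ha : DiffSec a x) (hb : DiffSec b x)
    {Z : ∀ x : M, Tan n x} (hZ : DiffVec Z x) :
    (tildeK H K a b x).2 (Z x)
      = H x (a x).1 (b x).1 (Z x)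
        - (1 / 2) * dfun (n := n) (fun y => pairing (a y) (b y)) x (Z x)
        + dfun (n := n) (fun y => (a y).2 (b y).1) x (Z x)
        + (b x).2 (conjConn K Z (fun y => (a y).1) x)
        - (a x).2 (conjConn K Z (fun y => (b y).1) x) := by
  obtain ⟨ha1, ha2⟩ := diffSec_iff.1 ha
  obtain ⟨hb1, hb2⟩ := diffSec_iff.1 hb
  have e1 := extDerivOneForm_apply hb2 ha1 hZ
  have e2 := extDerivOneForm_apply ha2 hb1 hZ
  have e3 := dualConn_apply K hb2 (fun y => (a y).1) hZ
  have e4 := dualConn_apply K ha2 (fun y => (b y).1) hZ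
  simp only [tildeK, courantSk_eq hH ha hb, dorfman, lieDerivOneForm, conjConn, Prod.snd_add,
    Prod.snd_sub, add_apply, sub_apply,
    smul_apply, smul_eq_mul, zero_apply, e1, e2, e3, e4, extDerivAux, map_sub]
  ring

/-! ### Coordinate frames -/

/-- The differential of a smooth function is a smooth one-form. -/
theorem contMDiffAt_dfun {f : M → ℝ} {x : M} (hf : ContMDiffAt (𝓡 n) 𝓘(ℝ, ℝ) ∞ f x) :
   ContMDiffAt (𝓡 n) ((𝓡 n).prod 𝓘(ℝ, Mod n →L[ℝ] ℝ)) ∞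
    (fun y => TotalSpace.mk' (Mod n →L[ℝ] ℝ)
      (E := fun y : M => TangentSpace (𝓡 n) y →L[ℝ] ℝ) y (dfun (n := n) f y)) x := by
  rw [contMDiffAt_section]
  have h := hf.mfderiv_const (m := ∞) (by simp)
  refine h.congr_of_eventuallyEq (Filter.Eventually.of_forall fun y => ?_)
  simp only [hom_trivializationAt_apply]
  unfold inTangentCoordinates ContinuousLinearMap.inCoordinates
  ext v
  simp
  rfl

omit [IsManifold (𝓡 n) ∞ M] in
theorem isInvertible_mfderiv_chart (he : e ∈ IsManifold.maximalAtlas (𝓡 n) ∞ M)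
    (hx : x ∈ e.source) : (mfderiv (𝓡 n) 𝓘(ℝ, Mod n) e x).IsInvertible := by
  have he1 : e ∈ IsManifold.maximalAtlas (𝓡 n) 1 M :=
    IsManifold.maximalAtlas_subset_of_le (by simp) he
  have hd : e.MDifferentiable (𝓡 n) (𝓡 n) :=
    ⟨(contMDiffOn_of_mem_maximalAtlas he1).mdifferentiableOn (by simp),
     (contMDiffOn_symm_of_mem_maximalAtlas he1).mdifferentiableOn (by simp)⟩
  exact ⟨hd.mfderiv hx, rfl⟩

/-- A constant vector field on `ℝⁿ`.  The coordinate fields of a chart are the pullbacks of constant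
fields, so that they are smooth and commute. -/
def constVec (w : Mod n) (y : Mod n) : TangentSpace 𝓘(ℝ, Mod n) y := w

theorem contMDiff_constVec (w : Mod n) :
    ContMDiff 𝓘(ℝ, Mod n) (𝓘(ℝ, Mod n).tangent) ∞
      (fun z => (TotalSpace.mk' (Mod n) z (constVec w z) : TangentBundle 𝓘(ℝ, Mod n) (Mod n))) := by
  intro y
  rw [contMDiffAt_section]
  simpa [constVec] using! contMDiffAt_const

theorem lieBracket_constVec (v w : Mod n) (y : Mod n) :
    VectorField.mlieBracket 𝓘(ℝ, Mod n) (constVec v) (constVec w) y = 0 := by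
  rw [← VectorField.mlieBracketWithin_univ, VectorField.mlieBracketWithin_eq_lieBracketWithin]
  unfold VectorField.lieBracketWithin constVec
  simp only [fderivWithin_fun_const, Pi.zero_apply, zero_apply, sub_zero]
  rfl

theorem coordVec_smooth (he : e ∈ IsManifold.maximalAtlas (𝓡 n) ∞ M) (μ : Fin n) :
    SmoothVec e.source (coordVec e μ) := by
  intro x hx
  exact (ContMDiffAt.mpullback_vectorField_preimage (I' := 𝓘(ℝ, Mod n)) (f := e) (n := ∞)
    (contMDiff_constVec (EuclideanSpace.single μ (1 : ℝ))).contMDiffAt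
    (contMDiffAt_of_mem_maximalAtlas he hx) (isInvertible_mfderiv_chart he hx)
    (by simp)).contMDiffWithinAt

theorem mlieBracket_coordVec (he : e ∈ IsManifold.maximalAtlas (𝓡 n) ∞ M) (hx : x ∈ e.source)
    (ν μ : Fin n) : VectorField.mlieBracket (𝓡 n) (coordVec e ν) (coordVec e μ) x = 0 := by
  have hc (κ : Fin n) := (contMDiff_constVec
    (EuclideanSpace.single κ (1 : ℝ))).mdifferentiable (by simp) (e x)
  have : IsManifold (𝓡 n) (minSmoothness ℝ 2) M := .of_le (n := ∞) (by simpa using ENat.LEInfty.out)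
  have h := VectorField.mpullback_mlieBracket (I := 𝓡 n) (n := ∞) (hc ν) (hc μ)
    (contMDiffAt_of_mem_maximalAtlas he hx) (by simpa using ENat.LEInfty.out)
  refine h.symm.trans ?_
  rw [VectorField.mpullback_apply, lieBracket_constVec, map_zero]

omit [IsManifold (𝓡 n) ∞ M] in
theorem coordForm_apply (he : e ∈ IsManifold.maximalAtlas (𝓡 n) ∞ M) (hx : x ∈ e.source)
    (κ : Fin n) (v : Tan n x) :
    coordForm e κ x v
      = (EuclideanSpace.proj κ : Mod n →L[ℝ] ℝ) (mfderiv (𝓡 n) 𝓘(ℝ, Mod n) e x v) := by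
  have he' : MDifferentiableAt (𝓡 n) 𝓘(ℝ, Mod n) e x :=
    (contMDiffAt_of_mem_maximalAtlas he hx).mdifferentiableAt (by simp)
  have h := mvfderiv_comp_apply (I' := 𝓘(ℝ, Mod n)) x
    ((EuclideanSpace.proj κ : Mod n →L[ℝ] ℝ).mdifferentiableAt) he' v
  refine h.trans ?_
  rw [mvfderiv, ContinuousLinearMap.mfderiv_eq]
  rfl

omit [IsManifold (𝓡 n) ∞ M] in
theorem coordForm_coordVec (he : e ∈ IsManifold.maximalAtlas (𝓡 n) ∞ M) (hx : x ∈ e.source)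
    (κ μ : Fin n) : coordForm e κ x (coordVec e μ x) = if κ = μ then 1 else 0 := by
  have h := (isInvertible_mfderiv_chart he hx).self_apply_inverse
    (EuclideanSpace.single μ (1 : ℝ))
  rw [coordForm_apply he hx]
  refine (congrArg (EuclideanSpace.proj κ : Mod n →L[ℝ] ℝ) h).trans ?_
  simp

omit [IsManifold (𝓡 n) ∞ M] in
theorem sum_coordForm_smul_coordVec (he : e ∈ IsManifold.maximalAtlas (𝓡 n) ∞ M)
    (hx : x ∈ e.source) (v : Tan n x) : ∑ κ, coordForm e κ x v • coordVec e κ x = v := by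
  have hinj : Function.Injective (mfderiv (𝓡 n) 𝓘(ℝ, Mod n) e x) :=
    (isInvertible_mfderiv_chart he hx).injective
  have hcoord : ∀ w : Tan n x, (∀ μ, coordForm e μ x w = coordForm e μ x v) → w = v := by
    intro w hw
    apply hinj
    refine PiLp.ext (p := 2) fun μ => ?_
    have := hw μ
    rwa [coordForm_apply he hx, coordForm_apply he hx] at this
  refine hcoord _ fun μ => ?_
  simp [coordForm_coordVec he hx]

omit [IsManifold (𝓡 n) ∞ M] in
theorem sum_apply_coordVec_smul_coordForm (he : e ∈ IsManifold.maximalAtlas (𝓡 n) ∞ M)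
    (hx : x ∈ e.source) (θ : Cot n x) : ∑ κ, θ (coordVec e κ x) • coordForm e κ x = θ := by
  ext v
  conv_rhs => rw [← sum_coordForm_smul_coordVec he hx v]
  simp [mul_comm]

theorem coordForm_smooth (he : e ∈ IsManifold.maximalAtlas (𝓡 n) ∞ M) (κ : Fin n) :
    SmoothForm e.source (coordForm e κ) := by
  intro x hx
  refine (contMDiffAt_dfun ?_).contMDiffWithinAt
  exact (EuclideanSpace.proj (𝕜 := ℝ) κ : Mod n →L[ℝ] ℝ).contMDiff.contMDiffAt.comp x
    (contMDiffAt_of_mem_maximalAtlas he hx)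

theorem coordVec_diff (he : e ∈ IsManifold.maximalAtlas (𝓡 n) ∞ M) (hx : x ∈ e.source)
    (μ : Fin n) : DiffVec (coordVec e μ) x :=
  ((coordVec_smooth he μ).contMDiffAt (e.open_source.mem_nhds hx)).mdifferentiableAt (by simp)

theorem coordForm_diff (he : e ∈ IsManifold.maximalAtlas (𝓡 n) ∞ M) (hx : x ∈ e.source)
    (κ : Fin n) : DiffForm (coordForm e κ) x :=
  ((coordForm_smooth he κ).contMDiffAt (e.open_source.mem_nhds hx)).mdifferentiableAt (by simp)

omit [IsManifold (𝓡 n) ∞ M] in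
theorem dfun_congr {f g : M → ℝ} (h : f =ᶠ[nhds x] g) :
    dfun (n := n) f x = dfun (n := n) g x :=
  h.mfderiv_eq

/-- The coefficients of the dual connection on the coframe are minus those of `∇^K` on the frame, since
the functions `dx^κ(∂_μ)` are constant. -/
theorem connCoeff_eq (K : AffineConnection n M) (he : e ∈ IsManifold.maximalAtlas (𝓡 n) ∞ M)
    (hx : x ∈ e.source) (ν κ μ : Fin n) :
    connCoeff K e ν κ μ x = - coordForm e κ x (K.toFun (coordVec e μ) x (coordVec e ν x)) := by
  rw [connCoeff, dualConn_apply K (coordForm_diff he hx κ) _ (coordVec_diff he hx μ)]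
  have h : (fun y => coordForm e κ y (coordVec e μ y))
      =ᶠ[nhds x] fun _ => if κ = μ then (1 : ℝ) else 0 := by
    filter_upwards [e.open_source.mem_nhds hx] with y hy using coordForm_coordVec he hy κ μ
  rw [dfun_congr h, dfun, mvfderiv_const, zero_apply, zero_sub]

/-- The bracket of a combination of vector fields with function coefficients. -/
theorem mlieBracket_sum_smul_left {ι : Type*} (s : Finset ι) (f : ι → M → ℝ)
    (V : ι → ∀ x : M, Tan n x) (Z : ∀ x : M, Tan n x)
    (hf : ∀ i, MDifferentiableAt (𝓡 n) 𝓘(ℝ, ℝ) (f i) x) (hV : ∀ i, DiffVec (V i) x) :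
    VectorField.mlieBracket (𝓡 n) (fun y => ∑ i ∈ s, f i y • V i y) Z x
      = ∑ i ∈ s, (- dfun (n := n) (f i) x (Z x) • V i x
          + f i x • VectorField.mlieBracket (𝓡 n) (V i) Z x) := by
  classical
  induction s using Finset.induction_on with
  | empty =>
    simp only [Finset.sum_empty]
    exact congrFun VectorField.mlieBracket_zero_left x
  | insert i s hi ih =>
    simp only [Finset.sum_insert hi]
    have h1 : DiffVec (f i • V i) x := (hf i).smul_section (hV i)
    have h2 : DiffVec (fun y => ∑ j ∈ s, f j y • V j y) x :=
      .sum_section fun j _ => (hf j).smul_section (hV j)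
    have h := VectorField.mlieBracket_add_left (W := Z) h1 h2
    rw [VectorField.mlieBracket_smul_left (hf i) (hV i), ih] at h
    exact h

/-- In coordinates `∇̄_{∂_μ} X = (∂_μ X^κ - K_ν{}^κ{}_μ X^ν) ∂_κ`. -/
theorem apply_conjConn_coordVec (K : AffineConnection n M)
    (he : e ∈ IsManifold.maximalAtlas (𝓡 n) ∞ M) (hx : x ∈ e.source) (θ : Cot n x)
    {X : ∀ x : M, Tan n x} (hX : DiffVec X x) (μ : Fin n) :
    θ (conjConn K (coordVec e μ) X x)
      = ∑ ν, θ (coordVec e ν x)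
          * dfun (n := n) (fun y => coordForm e ν y (X y)) x (coordVec e μ x)
        - ∑ ν, ∑ κ, connCoeff K e ν κ μ x * coordForm e ν x (X x) * θ (coordVec e κ x) := by
  have hXe : X =ᶠ[nhds x] fun y => ∑ ν, coordForm e ν y (X y) • coordVec e ν y := by
    filter_upwards [e.open_source.mem_nhds hx] with y hy
    exact (sum_coordForm_smul_coordVec he hy (X y)).symm
  have hbr : VectorField.mlieBracket (𝓡 n) X (coordVec e μ) x
      = ∑ ν, - dfun (n := n) (fun y => coordForm e ν y (X y)) x (coordVec e μ x)
          • coordVec e ν x := by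
    refine (hXe.mlieBracket_vectorField_eq (Filter.EventuallyEq.refl _ (coordVec e μ))).trans
      ((mlieBracket_sum_smul_left Finset.univ _ _ (coordVec e μ)
        (fun ν => differentiable_pair (coordForm_diff he hx ν) hX) (coordVec_diff he hx)).trans ?_)
    simp only [mlieBracket_coordVec he hx, smul_zero, add_zero]
  have hK : θ (K.toFun (coordVec e μ) x (X x))
      = - ∑ ν, ∑ κ, connCoeff K e ν κ μ x * coordForm e ν x (X x) * θ (coordVec e κ x) := by
    conv_lhs => rw [← sum_coordForm_smul_coordVec he hx (X x)]
    simp only [map_sum, map_smul, smul_eq_mul, ← Finset.sum_neg_distrib]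
    refine Finset.sum_congr rfl fun ν _ => ?_
    conv_lhs => rw [← sum_coordForm_smul_coordVec he hx (K.toFun (coordVec e μ) x (coordVec e ν x))]
    simp only [map_sum, map_smul, smul_eq_mul, Finset.mul_sum]
    refine Finset.sum_congr rfl fun κ _ => ?_
    rw [connCoeff_eq K he hx]
    ring
  rw [conjConn, map_sub, hK, hbr]
  simp only [map_sum, map_smul, smul_eq_mul, neg_mul, Finset.sum_neg_distrib]
  rw [sub_neg_eq_add, neg_add_eq_sub]
  simp only [mul_comm]

/-- Leibniz rule for `η(X) = X^κ η_κ`. -/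
theorem dfun_apply_coord (he : e ∈ IsManifold.maximalAtlas (𝓡 n) ∞ M) (hx : x ∈ e.source)
    {η : ∀ x : M, Cot n x} {X : ∀ x : M, Tan n x} (hη : DiffForm η x) (hX : DiffVec X x)
    (v : Tan n x) :
    dfun (n := n) (fun y => η y (X y)) x v
      = ∑ κ, (coordForm e κ x (X x) * dfun (n := n) (fun y => η y (coordVec e κ y)) x v
        + η x (coordVec e κ x) * dfun (n := n) (fun y => coordForm e κ y (X y)) x v) := by
  have h : (fun y => η y (X y))
      =ᶠ[nhds x] fun y => ∑ κ, coordForm e κ y (X y) * η y (coordVec e κ y) := by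
    filter_upwards [e.open_source.mem_nhds hx] with y hy
    conv_lhs => rw [← sum_coordForm_smul_coordVec he hy (X y)]
    simp only [map_sum, map_smul, smul_eq_mul]
  have h1 (κ : Fin n) := differentiable_pair (coordForm_diff he hx κ) hX
  have h2 (κ : Fin n) := differentiable_pair hη (coordVec_diff he hx κ)
  have hsum : ∀ s : Finset (Fin n),
      MDifferentiableAt (𝓡 n) 𝓘(ℝ, ℝ)
        (fun y => ∑ κ ∈ s, coordForm e κ y (X y) * η y (coordVec e κ y)) x ∧
      dfun (n := n) (fun y => ∑ κ ∈ s, coordForm e κ y (X y) * η y (coordVec e κ y)) x v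
        = ∑ κ ∈ s, (coordForm e κ x (X x) * dfun (n := n) (fun y => η y (coordVec e κ y)) x v
        + η x (coordVec e κ x) * dfun (n := n) (fun y => coordForm e κ y (X y)) x v) := by
    classical
    intro s
    induction s using Finset.induction_on with
    | empty =>
      simp only [Finset.sum_empty]
      exact ⟨mdifferentiableAt_const, by rw [dfun, mvfderiv_const, zero_apply]⟩
    | insert i s hi ih =>
      simp only [Finset.sum_insert hi]
      have h12 : MDifferentiableAt (𝓡 n) 𝓘(ℝ, ℝ)
          (fun y => coordForm e i y (X y) * η y (coordVec e i y)) x := (h1 i).mul (h2 i)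
      refine ⟨h12.add ih.1, ?_⟩
      rw [dfun, mvfderiv_fun_add h12 ih.1, add_apply, ih.2,
        mvfderiv_fun_mul (h1 i) (h2 i)]
      simp
  rw [dfun_congr h, (hsum Finset.univ).2]

/-- For arbitrary sections of `𝕋M` the local expression of `φ^{KL}` differs from the components of
`-K̃(a,b) + H(X,Y,·)` by `½ d⟨a,b⟩`. -/
theorem obstructionLocal_eq {H : Trilin n M} (hH : IsClosedThreeForm H) (K : AffineConnection n M)
    (he : e ∈ IsManifold.maximalAtlas (𝓡 n) ∞ M) (hx : x ∈ e.source)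
    {a b : ∀ x : M, GenTan n x} (ha : DiffSec a x) (hb : DiffSec b x) (μ : Fin n) :
    obstructionLocal K e a b μ x
      = - (tildeK H K a b x).2 (coordVec e μ x) + H x (a x).1 (b x).1 (coordVec e μ x)
        + (1 / 2) * dfun (n := n) (fun y => pairing (a y) (b y)) x (coordVec e μ x) := by
  obtain ⟨ha1, ha2⟩ := diffSec_iff.1 ha
  obtain ⟨hb1, hb2⟩ := diffSec_iff.1 hb
  rw [tildeK_snd_apply hH K ha hb (coordVec_diff he hx μ),
    apply_conjConn_coordVec K he hx _ ha1, apply_conjConn_coordVec K he hx _ hb1]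
  rw [dfun_pairing ha hb, add_apply, dfun_apply_coord he hx hb2 ha1]
  rw [obstructionLocal]
  simp only [compVec.eq_1 e _ _ x, compForm.eq_1 e _ _ x, Finset.sum_add_distrib, Finset.sum_sub_distrib]
  have hc (κ : Fin n) : (fun y => coordForm e κ y (b y).1) = compVec e b κ := rfl
  have hf (κ : Fin n) : (fun y => (b y).2 (coordVec e κ y)) = compForm e b κ := rfl
  simp only [hc, hf, mul_comm (dfun (n := n) (compVec e b _) x _)]
  ring

omit [IsManifold (𝓡 n) ∞ M] in
theorem cot_ext (he : e ∈ IsManifold.maximalAtlas (𝓡 n) ∞ M) (hx : x ∈ e.source)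
    {θ θ' : Cot n x} (h : ∀ μ, θ (coordVec e μ x) = θ' (coordVec e μ x)) : θ = θ' := by
  rw [← sum_apply_coordVec_smul_coordForm he hx θ, ← sum_apply_coordVec_smul_coordForm he hx θ']
  simp only [h]

/-! ### The obstruction form and its tensoriality -/

/-- The one-form `-K̃(a,b) + H(X,Y,·)`, for `a = X + ξ` and `b = Y + η`.  On sections of a Dirac
structure this is `φ^{KL}(a,b)`. -/
def obstructionForm (H : Trilin n M) (K : AffineConnection n M) (a b : ∀ x : M, GenTan n x)
    (x : M) : Cot n x :=
  - (tildeK H K a b x).2 + H x (a x).1 (b x).1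

theorem obstructionForm_swap (hH : IsClosedThreeForm H) (K : AffineConnection n M)
    (a b : ∀ x : M, GenTan n x) (x : M) :
    obstructionForm H K b a x = - obstructionForm H K a b x := by
  rw [obstructionForm, obstructionForm, tildeK_swap H K a b, hH.swap x (a x).1 (b x).1,
    Prod.snd_neg, neg_add]

theorem DiracStructure.dfun_pairing_eq_zero (L : DiracStructure H) (a b : ∀ x : M, L.fibre x)
    (x : M) :
    dfun (n := n) (fun y => pairing (a y : GenTan n y) (b y : GenTan n y)) x = 0 := by
  have h : (fun y => pairing (a y : GenTan n y) (b y : GenTan n y)) = fun _ => (0 : ℝ) :=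
    funext fun y => (L.lagrangian y (a y)).1 (a y).2 (b y) (b y).2
  rw [h, dfun, mvfderiv_const]

theorem obstructionForm_apply_coordVec (hH : IsClosedThreeForm H) (K : AffineConnection n M)
    (L : DiracStructure H)
    (he : e ∈ IsManifold.maximalAtlas (𝓡 n) ∞ M) (hx : x ∈ e.source)
    {a b : ∀ x : M, L.fibre x} (ha : DiffSec (fun y => (a y : GenTan n y)) x)
    (hb : DiffSec (fun y => (b y : GenTan n y)) x) (μ : Fin n) :
    obstructionForm H K (fun y => a y) (fun y => b y) x (coordVec e μ x)
      = obstructionLocal K e (fun y => a y) (fun y => b y) μ x := by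
  rw [obstructionLocal_eq hH K he hx ha hb μ, L.dfun_pairing_eq_zero a b x, zero_apply, mul_zero,
    add_zero]
  rfl

omit [IsManifold (𝓡 n) ∞ M] in
theorem compVec_smul_add {a a₁ a₂ : ∀ x : M, GenTan n x} {c : ℝ} (h : a x = c • a₁ x + a₂ x)
    (κ : Fin n) : compVec e a κ x = c * compVec e a₁ κ x + compVec e a₂ κ x := by
  simp [compVec, h]

omit [IsManifold (𝓡 n) ∞ M] in
theorem compForm_smul_add {a a₁ a₂ : ∀ x : M, GenTan n x} {c : ℝ} (h : a x = c • a₁ x + a₂ x)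
    (κ : Fin n) : compForm e a κ x = c * compForm e a₁ κ x + compForm e a₂ κ x := by
  simp [compForm, h]

/-- `obstructionLocal` is pointwise and linear in its first argument. -/
theorem obstructionLocal_smul_add (K : AffineConnection n M) {a a₁ a₂ : ∀ x : M, GenTan n x} {c : ℝ}
    (h : a x = c • a₁ x + a₂ x) (b : ∀ x : M, GenTan n x) (μ : Fin n) :
    obstructionLocal K e a b μ x
      = c * obstructionLocal K e a₁ b μ x + obstructionLocal K e a₂ b μ x := by
  simp only [obstructionLocal, compVec_smul_add h, compForm_smul_add h]
  rw [mul_add, add_add_add_comm]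
  refine congrArg₂ (· + ·) ?_ ?_
  · rw [Finset.mul_sum, ← Finset.sum_add_distrib]
    exact Finset.sum_congr rfl fun κ _ => by ring
  · rw [Finset.mul_sum, ← Finset.sum_add_distrib]
    refine Finset.sum_congr rfl fun ν _ => ?_
    rw [Finset.mul_sum, ← Finset.sum_add_distrib]
    exact Finset.sum_congr rfl fun κ _ => by ring

/-- Additivity, homogeneity and, for `c = 0`, dependence on the value at the point only, in one
statement. -/
theorem obstructionForm_smul_add_left (hH : IsClosedThreeForm H) (K : AffineConnection n M)
    (L : DiracStructure H) {a a₁ a₂ b : ∀ x : M, L.fibre x} {c : ℝ}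
    (ha : DiffSec (fun y => (a y : GenTan n y)) x) (ha₁ : DiffSec (fun y => (a₁ y : GenTan n y)) x)
    (ha₂ : DiffSec (fun y => (a₂ y : GenTan n y)) x) (hb : DiffSec (fun y => (b y : GenTan n y)) x)
    (h : a x = c • a₁ x + a₂ x) :
    obstructionForm H K (fun y => a y) (fun y => b y) x
      = c • obstructionForm H K (fun y => a₁ y) (fun y => b y) x
        + obstructionForm H K (fun y => a₂ y) (fun y => b y) x := by
  have he : chartAt (Mod n) x ∈ IsManifold.maximalAtlas (𝓡 n) ∞ M :=
    IsManifold.chart_mem_maximalAtlas x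
  have hx := mem_chart_source (Mod n) x
  have h' : (a x : GenTan n x) = c • (a₁ x : GenTan n x) + a₂ x := by rw [h]; rfl
  refine cot_ext he hx fun μ => ?_
  rw [add_apply, smul_apply, smul_eq_mul, obstructionForm_apply_coordVec hH K L he hx ha hb,
    obstructionForm_apply_coordVec hH K L he hx ha₁ hb,
    obstructionForm_apply_coordVec hH K L he hx ha₂ hb]
  exact obstructionLocal_smul_add K (a := fun y => a y) (a₁ := fun y => a₁ y) (a₂ := fun y => a₂ y)
    h' _ μ

/-- Linearity in the second argument comes from linearity in the first one and skew-symmetry. -/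
theorem obstructionForm_smul_add_right (hH : IsClosedThreeForm H) (K : AffineConnection n M)
    (L : DiracStructure H) {a b b₁ b₂ : ∀ x : M, L.fibre x} {c : ℝ}
    (ha : DiffSec (fun y => (a y : GenTan n y)) x) (hb : DiffSec (fun y => (b y : GenTan n y)) x)
    (hb₁ : DiffSec (fun y => (b₁ y : GenTan n y)) x)
    (hb₂ : DiffSec (fun y => (b₂ y : GenTan n y)) x) (h : b x = c • b₁ x + b₂ x) :
    obstructionForm H K (fun y => a y) (fun y => b y) x
      = c • obstructionForm H K (fun y => a y) (fun y => b₁ y) x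
        + obstructionForm H K (fun y => a y) (fun y => b₂ y) x := by
  rw [obstructionForm_swap hH K (fun y => (b y : GenTan n y)),
    obstructionForm_swap hH K (fun y => (b₁ y : GenTan n y)),
    obstructionForm_swap hH K (fun y => (b₂ y : GenTan n y)),
    obstructionForm_smul_add_left hH K L hb hb₁ hb₂ ha h]
  module

/-- On sections of a Dirac structure `obstructionForm` depends only on the values at the point. -/
theorem obstructionForm_congr (hH : IsClosedThreeForm H) (K : AffineConnection n M)
    (L : DiracStructure H) {a a' b b' : ∀ x : M, L.fibre x}
    (ha : DiffSec (fun y => (a y : GenTan n y)) x) (ha' : DiffSec (fun y => (a' y : GenTan n y)) x)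
    (hb : DiffSec (fun y => (b y : GenTan n y)) x) (hb' : DiffSec (fun y => (b' y : GenTan n y)) x)
    (haa : a x = a' x) (hbb : b x = b' x) :
    obstructionForm H K (fun y => a y) (fun y => b y) x
      = obstructionForm H K (fun y => a' y) (fun y => b' y) x := by
  rw [obstructionForm_smul_add_left hH K L (c := 0) ha ha' ha' hb (by simpa using haa),
    obstructionForm_smul_add_right hH K L (c := 0) ha' hb hb' hb' (by simpa using hbb)]
  simp

/-- Vectors of `L` at a point extend to local sections, linearly: take constant coefficients in a
local frame, and zero outside its domain. -/
theorem DiracStructure.exists_extension (L : DiracStructure H) (x : M) :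
    ∃ σ : L.fibre x →ₗ[ℝ] ∀ y : M, L.fibre y, ∃ U : Set M, IsOpen U ∧ x ∈ U ∧
      ∀ v, SmoothSec U (fun y => (σ v y : GenTan n y)) ∧ σ v x = v := by
  classical
  obtain ⟨U, k, s, hU, hxU, hs, hspan⟩ := L.subbundle x
  let B : Module.Basis (Fin k) ℝ (L.fibre x) :=
    (Module.Basis.span (hspan x hxU).1).map (LinearEquiv.ofEq _ _ (hspan x hxU).2)
  have hB (i : Fin k) : (B i : GenTan n x) = s i x := by
    simp [B, Module.Basis.span_apply]
  have hmem (i : Fin k) (y : M) (hy : y ∈ U) : s i y ∈ L.fibre y := by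
    rw [← (hspan y hy).2]
    exact Submodule.subset_span ⟨i, rfl⟩
  let t (i : Fin k) (y : M) : L.fibre y := if hy : y ∈ U then ⟨s i y, hmem i y hy⟩ else 0
  have ht (i : Fin k) (y : M) (hy : y ∈ U) : (t i y : GenTan n y) = s i y := by
    simp [t, hy]
  refine ⟨∑ i, (B.coord i).smulRight (t i), U, hU, hxU, fun v => ⟨?_, ?_⟩⟩
  · have : SmoothSec U (fun y => ∑ i, B.coord i v • s i y) :=
      ContMDiffOn.sum_section fun i _ => (hs i).const_smul_section
    refine this.congr fun y hy => ?_
    simp [ht _ y hy]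
  · apply Subtype.ext
    have h := congrArg (L.fibre x).subtype (B.sum_repr v)
    rw [map_sum] at h
    simpa [ht _ x hxU, hB] using h

/-! ### Smoothness of the obstruction form -/

theorem smooth_pair {ξ : ∀ x : M, Cot n x} {Z : ∀ x : M, Tan n x} {U : Set M}
    (hξ : SmoothForm U ξ) (hZ : SmoothVec U Z) :
    ContMDiffOn (𝓡 n) 𝓘(ℝ, ℝ) ∞ (fun y => ξ y (Z y)) U := by
  have h := ContMDiffOn.clm_bundle_apply (E₂ := Bundle.Trivial M ℝ) (F₂ := ℝ) hξ hZ
  intro y hy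
  have h' := h y hy
  rw [contMDiffWithinAt_totalSpace] at h'
  exact h'.2

theorem smooth_dfun {f : M → ℝ} {U : Set M} (hU : IsOpen U)
    (hf : ContMDiffOn (𝓡 n) 𝓘(ℝ, ℝ) ∞ f U) : SmoothForm U (dfun (n := n) f) :=
  fun _ hx => (contMDiffAt_dfun (hf.contMDiffAt (hU.mem_nhds hx))).contMDiffWithinAt

/-- Smoothness of a connection is a condition on globally smooth sections; a local section is cut off
by a bump function to apply it. -/
theorem smoothVec_affineConnection [T2Space M] (K : AffineConnection n M)
    [hK : CovariantDerivative.ContMDiffCovariantDerivative K ∞] {U : Set M} (hU : IsOpen U)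
    {X Z : ∀ x : M, Tan n x} (hX : SmoothVec U X) (hZ : SmoothVec U Z) :
    SmoothVec U (fun y => K.toFun Z y (X y)) := by
  intro x hx
  obtain ⟨ψ, -, hψ⟩ := (SmoothBumpFunction.nhds_basis_tsupport (I := 𝓡 n) x |>.mem_iff.1
    (hU.mem_nhds hx))
  have hψs : ContMDiff (𝓡 n) 𝓘(ℝ, ℝ) ∞ ψ := ψ.contMDiff
  have hglob : ContMDiff (𝓡 n) ((𝓡 n).prod 𝓘(ℝ, Mod n)) ∞
      (fun y => TotalSpace.mk' (Mod n) (E := fun y : M => TangentSpace (𝓡 n) y) y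
        (((ψ : M → ℝ) • Z : ∀ y : M, Tan n y) y)) :=
    ContMDiffOn.smul_section_of_tsupport hψs.contMDiffOn hU hψ hZ
  have hKs := hK.contMDiff.contMDiff (σ := ((ψ : M → ℝ) • Z : ∀ y : M, Tan n y)) hglob.contMDiffOn
  have h := (hKs.contMDiffAt Filter.univ_mem).clm_bundle_apply (hX.contMDiffAt (hU.mem_nhds hx))
  refine (h.congr_of_eventuallyEq ?_).contMDiffWithinAt
  filter_upwards [ψ.eventuallyEq_one.eventually_nhds, hU.mem_nhds hx] with y hy hyU
  have : K.toFun Z y = K.toFun ((ψ : M → ℝ) • Z : ∀ y : M, Tan n y) y := by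
    refine K.isCovariantDerivativeOnUniv.congr_of_eventuallyEq
      ((hZ.contMDiffAt (hU.mem_nhds hyU)).mdifferentiableAt (by simp))
      (hglob.contMDiffAt.mdifferentiableAt (by simp)) Filter.univ_mem ?_
    filter_upwards [hy] with z hz
    simp [hz]
  rw [this]

theorem connCoeff_smooth [T2Space M] (K : AffineConnection n M)
    [CovariantDerivative.ContMDiffCovariantDerivative K ∞]
    (he : e ∈ IsManifold.maximalAtlas (𝓡 n) ∞ M) (ν κ μ : Fin n) :
    ContMDiffOn (𝓡 n) 𝓘(ℝ, ℝ) ∞ (connCoeff K e ν κ μ) e.source := by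
  refine (smooth_pair (coordForm_smooth he κ) (smoothVec_affineConnection K e.open_source
    (coordVec_smooth he ν) (coordVec_smooth he μ))).neg.congr fun y hy => ?_
  exact connCoeff_eq K he hy ν κ μ

theorem obstructionLocal_smooth [T2Space M] (K : AffineConnection n M)
    [CovariantDerivative.ContMDiffCovariantDerivative K ∞]
    (he : e ∈ IsManifold.maximalAtlas (𝓡 n) ∞ M) {U : Set M} (hU : IsOpen U) (hUe : U ⊆ e.source)
    {a b : ∀ x : M, GenTan n x} (ha : SmoothSec U a) (hb : SmoothSec U b) (μ : Fin n) :
    ContMDiffOn (𝓡 n) 𝓘(ℝ, ℝ) ∞ (obstructionLocal K e a b μ) U := by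
  have hV {c : ∀ x : M, GenTan n x} (hc : SmoothSec U c) (κ : Fin n) :
      ContMDiffOn (𝓡 n) 𝓘(ℝ, ℝ) ∞ (compVec e c κ) U :=
    smooth_pair ((coordForm_smooth he κ).mono hUe) (smoothSec_iff.1 hc).1
  have hF {c : ∀ x : M, GenTan n x} (hc : SmoothSec U c) (κ : Fin n) :
      ContMDiffOn (𝓡 n) 𝓘(ℝ, ℝ) ∞ (compForm e c κ) U :=
    smooth_pair (smoothSec_iff.1 hc).2 ((coordVec_smooth he κ).mono hUe)
  have hd {f : M → ℝ} (hf : ContMDiffOn (𝓡 n) 𝓘(ℝ, ℝ) ∞ f U) :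
      ContMDiffOn (𝓡 n) 𝓘(ℝ, ℝ) ∞ (fun y => dfun (n := n) f y (coordVec e μ y)) U :=
    smooth_pair (smooth_dfun hU hf) ((coordVec_smooth he μ).mono hUe)
  have hC (ν κ : Fin n) := (connCoeff_smooth K he ν κ μ).mono hUe
  refine ContMDiffOn.add ?_ ?_
  · refine contMDiffOn_finsetSum fun κ _ => ?_
    exact ((hV ha κ).mul (hd (hF hb κ))).add ((hd (hV hb κ)).mul (hF ha κ))
  · refine contMDiffOn_finsetSum fun ν _ => contMDiffOn_finsetSum fun κ _ => ?_
    exact (((hC ν κ).mul (hV ha ν)).mul (hF hb κ)).sub (((hC ν κ).mul (hV hb ν)).mul (hF ha κ))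

theorem obstructionForm_smooth [T2Space M] (hH : IsClosedThreeForm H) (K : AffineConnection n M)
    [CovariantDerivative.ContMDiffCovariantDerivative K ∞] (L : DiracStructure H) {U : Set M}
    (hU : IsOpen U) {a b : ∀ x : M, L.fibre x} (ha : SmoothSec U (fun y => (a y : GenTan n y)))
    (hb : SmoothSec U (fun y => (b y : GenTan n y))) :
    SmoothForm U (obstructionForm H K (fun y => a y) (fun y => b y)) := by
  intro x hx
  have he : chartAt (Mod n) x ∈ IsManifold.maximalAtlas (𝓡 n) ∞ M :=
    IsManifold.chart_mem_maximalAtlas x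
  set e := chartAt (Mod n) x
  have hW : IsOpen (U ∩ e.source) := hU.inter e.open_source
  have hxW : x ∈ U ∩ e.source := ⟨hx, mem_chart_source (Mod n) x⟩
  have h : SmoothForm (U ∩ e.source) (fun y => ∑ μ,
      obstructionLocal K e (fun y => a y) (fun y => b y) μ y • coordForm e μ y) :=
    ContMDiffOn.sum_section fun μ _ =>
      (obstructionLocal_smooth K he hW Set.inter_subset_right (ha.mono Set.inter_subset_left)
        (hb.mono Set.inter_subset_left) μ).smul_section
        ((coordForm_smooth he μ).mono Set.inter_subset_right)
  refine ((h.congr fun y hy => ?_).contMDiffAt (hW.mem_nhds hxW)).contMDiffWithinAt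
  rw [← sum_apply_coordVec_smul_coordForm he hy.2 (obstructionForm H K _ _ y)]
  simp only [obstructionForm_apply_coordVec hH K L he hy.2 (ha.diffSec hU hy.1)
    (hb.diffSec hU hy.1)]

/-! ### The obstruction tensor on a Dirac structure -/

/-- On sections of a Dirac structure `obstructionForm` comes from a bilinear map on each fibre. -/
theorem exists_obstructionTensor (hH : IsClosedThreeForm H) (K : AffineConnection n M)
    (L : DiracStructure H) :
    ∃ φ : ∀ x : M, L.fibre x →ₗ[ℝ] L.fibre x →ₗ[ℝ] Cot n x,
      ∀ (x : M) (a b : ∀ x : M, L.fibre x), DiffSec (fun y => (a y : GenTan n y)) x →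
        DiffSec (fun y => (b y : GenTan n y)) x →
          φ x (a x) (b x) = obstructionForm H K (fun y => a y) (fun y => b y) x := by
  choose σ U hU hxU hσ using L.exists_extension
  have hd (x : M) (u : L.fibre x) : DiffSec (fun y => (σ x u y : GenTan n y)) x :=
    (hσ x u).1.diffSec (hU x) (hxU x)
  have hv (x : M) (u : L.fibre x) : σ x u x = u := (hσ x u).2
  refine ⟨fun x => LinearMap.mk₂ ℝ
    (fun u v => obstructionForm H K (fun y => σ x u y) (fun y => σ x v y) x) ?_ ?_ ?_ ?_,
    fun x a b ha hb => ?_⟩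
  · intro u u' v
    rw [obstructionForm_smul_add_left hH K L (c := 1) (hd x (u + u')) (hd x u) (hd x u') (hd x v)
      (by simp [hv]), one_smul]
  · intro c u v
    -- `c • u = (c - 1) • u + u`
    rw [obstructionForm_smul_add_left hH K L (c := c - 1) (hd x (c • u)) (hd x u) (hd x u) (hd x v)
      (by rw [hv, hv]; module)]
    module
  · intro u v v'
    rw [obstructionForm_smul_add_right hH K L (c := 1) (hd x u) (hd x (v + v')) (hd x v) (hd x v')
      (by simp [hv]), one_smul]
  · intro c u v
    rw [obstructionForm_smul_add_right hH K L (c := c - 1) (hd x u) (hd x (c • v)) (hd x v) (hd x v)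
      (by rw [hv, hv]; module)]
    module
  · exact obstructionForm_congr hH K L (hd x _) ha (hd x _) hb (hv x _) (hv x _)

theorem isObstructionTensor_of_eq [T2Space M] (hH : IsClosedThreeForm H) (K : AffineConnection n M)
    [CovariantDerivative.ContMDiffCovariantDerivative K ∞] (L : DiracStructure H)
    {φ : ∀ x : M, L.fibre x →ₗ[ℝ] L.fibre x →ₗ[ℝ] Cot n x}
    (hφ : ∀ (x : M) (a b : ∀ x : M, L.fibre x), DiffSec (fun y => (a y : GenTan n y)) x →
        DiffSec (fun y => (b y : GenTan n y)) x →
          φ x (a x) (b x) = obstructionForm H K (fun y => a y) (fun y => b y) x) :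
    IsObstructionTensor L K φ where
  alt x u := by
    obtain ⟨σ, U, hU, hxU, hσ⟩ := L.exists_extension x
    have hd := (hσ u).1.diffSec hU hxU
    have h := hφ x (σ u) (σ u) hd hd
    rw [(hσ u).2] at h
    rw [h]
    ext v
    have h' := DFunLike.congr_fun
      (obstructionForm_swap hH K (fun y => (σ u y : GenTan n y)) (fun y => σ u y) x) v
    rw [neg_apply] at h'
    rw [zero_apply]
    linarith
  smooth U a b hU ha hb :=
    (obstructionForm_smooth hH K L hU ha hb).congr fun y hy =>
      congrArg (TotalSpace.mk' _ y) (hφ y a b (ha.diffSec hU hy) (hb.diffSec hU hy))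
  local_eq e he U a b hU hUe ha hb x hx μ := by
    rw [hφ x a b (ha.diffSec hU hx) (hb.diffSec hU hx)]
    exact obstructionForm_apply_coordVec hH K L he (hUe hx) (ha.diffSec hU hx) (hb.diffSec hU hx) μ

theorem IsObstructionTensor.unique {L : DiracStructure H} {K : AffineConnection n M}
    {φ ψ : ∀ x : M, L.fibre x →ₗ[ℝ] L.fibre x →ₗ[ℝ] Cot n x} (hφ : IsObstructionTensor L K φ)
    (hψ : IsObstructionTensor L K ψ) : ψ = φ := by
  funext x
  refine LinearMap.ext₂ fun u v => ?_
  obtain ⟨σ, U, hU, hxU, hσ⟩ := L.exists_extension x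
  have he : chartAt (Mod n) x ∈ IsManifold.maximalAtlas (𝓡 n) ∞ M :=
    IsManifold.chart_mem_maximalAtlas x
  have hx := mem_chart_source (Mod n) x
  refine cot_ext he hx fun μ => ?_
  have hW : IsOpen (U ∩ (chartAt (Mod n) x).source) := hU.inter (chartAt (Mod n) x).open_source
  have hs (w : L.fibre x) := (hσ w).1.mono
    (Set.inter_subset_left (s := U) (t := (chartAt (Mod n) x).source))
  have h1 := hφ.local_eq _ he _ (σ u) (σ v) hW Set.inter_subset_right (hs u) (hs v) x ⟨hxU, hx⟩ μ
  have h2 := hψ.local_eq _ he _ (σ u) (σ v) hW Set.inter_subset_right (hs u) (hs v) x ⟨hxU, hx⟩ μ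
  rw [← h1, (hσ u).2, (hσ v).2] at h2
  exact h2

end CourantTorsion

end

open CourantTorsion
theorem mainTheorem4 {n : ℕ} {M : Type*} [TopologicalSpace M] [T2Space M]
    [ChartedSpace (EuclideanSpace ℝ (Fin n)) M] [IsManifold (𝓡 n) ∞ M]
    (H : Trilin n M) (hH : IsClosedThreeForm H)
    (D : GenConnection n M)
    (K : AffineConnection n M)
    [hK : CovariantDerivative.ContMDiffCovariantDerivative K ∞] :
    (∀ (U : Set M) (a b : ∀ x : M, GenTan n x), IsOpen U →
      SmoothSec U a → SmoothSec U b → ∀ x ∈ U,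
        kTorsion D K a b x
            = naiveTorsion H D a b x + tildeK H K a b x
        ∧ kTorsion D K a b x
            = dorfmanTorsion H D a b x + tildeK H K a b x
              + (0, (1 / 2 : ℝ) •
                  dfun (fun y => pairing (a y) (b y)) x)
        ∧ kTorsionFlux H D K a b x
            = naiveTorsion zeroFlux D a b x + tildeK H K a b x)
    ∧ ∀ L : DiracStructure H,
        ∃ φ : ∀ x : M, L.fibre x →ₗ[ℝ] L.fibre x →ₗ[ℝ] Cot n x,
          IsObstructionTensor L K φ
          ∧ (∀ ψ, IsObstructionTensor L K ψ → ψ = φ)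
          ∧ ∀ (U : Set M) (a b : ∀ x : M, L.fibre x), IsOpen U →
              SmoothSec U (fun x => (a x : GenTan n x)) →
              SmoothSec U (fun x => (b x : GenTan n x)) →
              ∀ x ∈ U,
                tildeK H K (fun y => a y) (fun y => b y) x
                    = (0, - φ x (a x) (b x)
                        + H x (a x : GenTan n x).1
                            (b x : GenTan n x).1)
                ∧ tildeK H K (fun y => a y) (fun y => b y) x
                    = (0, (dorfman H (fun y => a y) (fun y => b y) x).2
                        + dualConn K (fun y => (b y : GenTan n y).1)
                            (fun y => (a y : GenTan n y).2) x
                        - dualConn K (fun y => (a y : GenTan n y).1)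
                            (fun y => (b y : GenTan n y).2) x)
                ∧ kTorsion D K (fun y => a y) (fun y => b y) x
                    = dorfmanTorsion H D (fun y => a y) (fun y => b y) x
                        + tildeK H K (fun y => a y) (fun y => b y) x := by
  refine ⟨fun U a b hU hsa hsb x hx => ?_, fun L => ?_⟩
  · have ha := hsa.diffSec hU hx
    have hb := hsb.diffSec hU hx
    exact ⟨kTorsion_eq_naiveTorsion_add H D K ha hb, kTorsion_eq_dorfmanTorsion_add hH D K ha hb,
      kTorsionFlux_eq hH D K ha hb⟩
  · obtain ⟨φ, hφ⟩ := exists_obstructionTensor hH K L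
    have hφ' := isObstructionTensor_of_eq hH K L hφ
    refine ⟨φ, hφ', fun ψ hψ => hφ'.unique hψ, fun U a b hU hsa hsb x hx => ?_⟩
    have ha := hsa.diffSec hU hx
    have hb := hsb.diffSec hU hx
    have h0 : dfun (n := n) (fun y => pairing (a y : GenTan n y) (b y : GenTan n y)) x = 0 :=
      L.dfun_pairing_eq_zero a b x
    refine ⟨Prod.ext (tildeK_fst H K _ _ x) ?_, Prod.ext (tildeK_fst H K _ _ x) ?_, ?_⟩
    · rw [hφ x a b ha hb, obstructionForm, neg_add, neg_neg, neg_add_cancel_right]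
    · rw [tildeK, courantSk_eq hH ha hb, h0]
      simp
    · rw [kTorsion_eq_dorfmanTorsion_add hH D K ha hb, h0, smul_zero, Prod.mk_zero_zero, add_zero]
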